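/- Let $\mathcal B$ be a complete Boolean algebra with Stone space $Q$. Let $C(Q)$ be the algebra of continuous functions $Q\to\mathbb R$, and let $L^0(\mathcal B)=C_\infty(Q)$ be the algebra over $\mathbb R$ of all continuous functions $x\colon Q\to[-\infty,+\infty]$ that take the values $\pm\infty$ only on a nowhere dense set; for $x,y\in C_\infty(Q)$, the sum $x+y$ (resp. the product $xy$) is the unique element of $C_\infty(Q)$ that equals $x(t)+y(t)$ (resp. $x(t)y(t)$) at every point $t$ where both $x$ and $y$ are finite. Then $C(Q)\subset L^0(\mathcal B)$, and $e\in\mathcal B$ is identified with the indicator function of the clopen subset of $Q$ corresponding to $e$. The support of $x\in L^0(\mathcal B)$ is $s(x)=\mathbf 1-\sup\{e\in\mathcal B: ex=0\}\in\mathcal B$, and for $X\subset L^0(\mathcal B)$ put $s(X)=\sup\{s(x):x\in X\}$. If $X$ is an ideal of $C(Q)$ or $X=L^0(\mathcal B)$, a derivation $\delta\colon X\to L^0(\mathcal B)$ is an $\mathbb R$-linear map with $\delta(xy)=\delta(x)y+x\delta(y)$ for all $x,y\in X$; a derivation $\delta$ on an ideal $X$ is band preserving if $s(\delta(x))\le s(x)$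 for all $x\in X$. **Theorem.** Let $X$ be an ideal of $C(Q)$ and let $\delta\colon X\to L^0(\mathcal B)$ be a band preserving derivation. Then there exists a derivation $\hat\delta\colon L^0(\mathcal B)\to L^0(\mathcal B)$ such that $\hat\delta(x)=\delta(x)$ for all $x\in X$. If moreover $s(X)=\mathbf 1$, then such a derivation $\hat\delta$ is unique. -/

import Mathlib

open Set Filter Topology

noncomputable section

universe u

/-! ### The Stone space of a Boolean algebra -/

/-- The Stone space of a Boolean algebra `B`: the two-valued homomorphisms `B → Bool`
(equivalently, the ultrafilters of `B`), with the topology of pointwise convergence. -/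
def StoneSpace (B : Type u) [BooleanAlgebra B] : Type u := BoundedLatticeHom B Bool

namespace StoneSpace

section Boolean

variable {B : Type u} [BooleanAlgebra B]

/-- The value of a point of the Stone space at an element of the Boolean algebra. -/
def val (t : StoneSpace B) : B → Bool := fun b => DFunLike.coe (F := BoundedLatticeHom B Bool) t b

theorem val_injective : Function.Injective (val (B := B)) := fun _ _ h =>
  DFunLike.coe_injective (F := BoundedLatticeHom B Bool) h

@[simp] theorem val_sup (t : StoneSpace B) (a b : B) : t.val (a ⊔ b) = (t.val a ⊔ t.val b) :=
  map_sup (F := BoundedLatticeHom B Bool) t a b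

@[simp] theorem val_inf (t : StoneSpace B) (a b : B) : t.val (a ⊓ b) = (t.val a ⊓ t.val b) :=
  map_inf (F := BoundedLatticeHom B Bool) t a b

@[simp] theorem val_top (t : StoneSpace B) : t.val ⊤ = true :=
  map_top (F := BoundedLatticeHom B Bool) t

@[simp] theorem val_bot (t : StoneSpace B) : t.val ⊥ = false :=
  map_bot (F := BoundedLatticeHom B Bool) t

instance : TopologicalSpace (StoneSpace B) := TopologicalSpace.induced val inferInstance

theorem isInducing_val : IsInducing (val (B := B)) := ⟨rfl⟩

theorem continuous_val : Continuous (val (B := B)) := continuous_induced_dom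

theorem continuous_val_apply (b : B) : Continuous fun t : StoneSpace B => t.val b :=
  (continuous_apply b).comp continuous_val

theorem range_val : range (val (B := B)) =
    {f : B → Bool | (∀ a b, f (a ⊔ b) = (f a ⊔ f b)) ∧ (∀ a b, f (a ⊓ b) = (f a ⊓ f b)) ∧
      f ⊤ = true ∧ f ⊥ = false} := by
  ext f
  constructor
  · rintro ⟨t, rfl⟩
    exact ⟨t.val_sup, t.val_inf, t.val_top, t.val_bot⟩
  · rintro ⟨h1, h2, h3, h4⟩
    exact ⟨(⟨⟨⟨f, h1⟩, h2⟩, h3, h4⟩ : BoundedLatticeHom B Bool), rfl⟩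

instance : CompactSpace (StoneSpace B) := by
  have hcl : IsClosed (range (val (B := B))) := by
    rw [range_val]
    have hsup : Continuous fun p : Bool × Bool => p.1 ⊔ p.2 := continuous_of_discreteTopology
    have hinf : Continuous fun p : Bool × Bool => p.1 ⊓ p.2 := continuous_of_discreteTopology
    simp only [ofPred_and, ofPred_forall]
    refine IsClosed.inter ?_ (IsClosed.inter ?_ (IsClosed.inter ?_ ?_))
    · refine isClosed_iInter fun a => isClosed_iInter fun b => isClosed_eq (continuous_apply _) ?_
      exact hsup.comp (f := fun x : B → Bool => (x a, x b))
        ((continuous_apply a).prodMk (continuous_apply b))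
    · refine isClosed_iInter fun a => isClosed_iInter fun b => isClosed_eq (continuous_apply _) ?_
      exact hinf.comp (f := fun x : B → Bool => (x a, x b))
        ((continuous_apply a).prodMk (continuous_apply b))
    · exact isClosed_eq (continuous_apply _) continuous_const
    · exact isClosed_eq (continuous_apply _) continuous_const
  exact (IsClosedEmbedding.mk ⟨isInducing_val, val_injective⟩ hcl).compactSpace

instance : T2Space (StoneSpace B) := T2Space.of_injective_continuous val_injective continuous_val

/-- The clopen subset `Q(e)` of the Stone space that corresponds to `e`. -/
def clopen (e : B) : Set (StoneSpace B) := {t | t.val e = true}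

theorem isClopen_clopen (e : B) : IsClopen (clopen e) :=
  (isClopen_discrete ({true} : Set Bool)).preimage (continuous_val_apply e)

theorem val_compl (t : StoneSpace B) (b : B) : t.val bᶜ = !(t.val b) := by
  have h1 := t.val_sup b bᶜ
  have h2 := t.val_inf b bᶜ
  simp only [sup_compl_eq_top, inf_compl_eq_bot, val_top, val_bot] at h1 h2
  revert h1 h2
  cases t.val b <;> cases t.val bᶜ <;> simp

theorem exists_clopen_subset {U : Set (StoneSpace B)} (hU : IsOpen U) {t : StoneSpace B}
    (ht : t ∈ U) : ∃ e : B, t ∈ clopen e ∧ clopen e ⊆ U := by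
  obtain ⟨V, hV, rfl⟩ := isInducing_val.isOpen_iff.1 hU
  obtain ⟨I, w, hw, hIV⟩ := isOpen_pi_iff.1 hV t.val ht
  refine ⟨I.inf fun b => if t.val b = true then b else bᶜ, ?_, ?_⟩
  · have key : ∀ J : Finset B,
        t.val (J.inf fun b => if t.val b = true then b else bᶜ) = true := by
      intro J
      classical
      induction J using Finset.induction_on with
      | empty => simp
      | insert a J _ ih =>
        rw [Finset.inf_insert, val_inf, ih]
        split_ifs with h
        · simp [h]
        · simp [val_compl, h]
    exact key I
  · intro s hs
    refine hIV fun b hb => ?_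
    have h1 : s.val (if t.val b = true then b else bᶜ) = true := by
      have hle : (I.inf fun b => if t.val b = true then b else bᶜ) ≤
          (if t.val b = true then b else bᶜ) := Finset.inf_le hb
      have h2 := s.val_inf (I.inf fun b => if t.val b = true then b else bᶜ)
        (if t.val b = true then b else bᶜ)
      rw [inf_eq_left.2 hle, show s.val (I.inf fun b => if t.val b = true then b else bᶜ) = true
        from hs] at h2
      simpa using h2.symm
    have h3 : s.val b = t.val b := by
      split_ifs at h1 with h
      · rw [h1, h]
      · rw [val_compl] at h1
        simp only [Bool.not_eq_true'] at h1
        simp only [Bool.not_eq_true] at h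
        rw [h1, h]
    rw [h3]
    exact (hw b hb).2

theorem nonempty_clopen {e : B} (he : e ≠ ⊥) : (clopen e).Nonempty := by
  classical
  have hdis : Disjoint (Order.PFilter.principal e : Set B) ((⊥ : Order.Ideal B) : Set B) := by
    rw [Set.disjoint_left]
    rintro x hx hx'
    have h1 : e ≤ x := hx
    have h2 : x ≤ ⊥ := hx'
    exact he (le_bot_iff.1 (h1.trans h2))
  obtain ⟨J, hJ, -, hJd⟩ := DistribLattice.prime_ideal_of_disjoint_filter_ideal hdis
  have hmem : (fun b => decide (b ∉ J)) ∈ range (val (B := B)) := by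
    rw [range_val]
    refine ⟨fun a b => ?_, fun a b => ?_, ?_, ?_⟩
    · by_cases ha : a ∈ J <;> by_cases hb : b ∈ J <;> simp [ha, hb]
    · have h : a ⊓ b ∈ J ↔ a ∈ J ∨ b ∈ J :=
        ⟨fun h => hJ.mem_or_mem h,
          fun h => h.elim (fun h => J.lower inf_le_left h) fun h => J.lower inf_le_right h⟩
      by_cases ha : a ∈ J <;> by_cases hb : b ∈ J <;> simp [h, ha, hb]
    · have h : (⊤ : B) ∉ J := hJ.toIsProper.top_notMem
      simp [h]
    · simp
  obtain ⟨t, ht⟩ := hmem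
  refine ⟨t, ?_⟩
  have h : e ∉ J := Set.disjoint_left.1 hJd (le_refl e)
  show t.val e = true
  rw [ht]
  simp [h]

end Boolean

instance {B : Type u} [CompleteBooleanAlgebra B] : ExtremallyDisconnected (StoneSpace B) where
  open_closure U hU := by
    have hmono : ∀ {a b : B}, a ≤ b → clopen a ⊆ clopen b := by
      intro a b hab t (ht : t.val a = true)
      have h := t.val_inf a b
      rw [inf_eq_left.2 hab, ht] at h
      exact show t.val b = true by simpa using h.symm
    have hcl : closure U = clopen (sSup {b : B | clopen b ⊆ U}) := by
      apply Subset.antisymm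
      · refine closure_minimal (fun t ht => ?_) (isClopen_clopen _).isClosed
        obtain ⟨e, hte, heU⟩ := exists_clopen_subset hU ht
        exact hmono (le_sSup heU) hte
      · intro t ht
        by_contra hcon
        obtain ⟨c, htc, hc⟩ := exists_clopen_subset isClosed_closure.isOpen_compl hcon
        have h0 : c ⊓ sSup {b : B | clopen b ⊆ U} ≤ ⊥ := by
          rw [inf_sSup_eq]
          refine iSup₂_le fun b hb => ?_
          have hempty : clopen (c ⊓ b) = (∅ : Set (StoneSpace B)) := by
            refine eq_empty_of_forall_notMem fun s hs => ?_
            exact hc (hmono inf_le_left hs) (subset_closure (hb (hmono inf_le_right hs)))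
          by_contra hne
          exact (nonempty_clopen (fun h => hne h.le)).ne_empty hempty
        have h1 := t.val_inf c (sSup {b : B | clopen b ⊆ U})
        rw [le_bot_iff.1 h0, show t.val c = true from htc,
          show t.val (sSup {b : B | clopen b ⊆ U}) = true from ht] at h1
        simp at h1
    rw [hcl]
    exact (isClopen_clopen _).isOpen

end StoneSpace

/-! ### The algebra `C_∞(Q)` -/

section Extension

variable {Q : Type u} [TopologicalSpace Q]

/-- On an extremally disconnected compact Hausdorff space, a continuous function with values in
`[-∞, +∞]` extends from a dense open set to the whole space. -/
theorem exists_continuous_extension [CompactSpace Q] [T2Space Q] [ExtremallyDisconnected Q]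
    {U : Set Q} (hU : IsOpen U) (hd : Dense U) {f : Q → EReal} (hf : ContinuousOn f U) :
    ∃ z : C(Q, EReal), ∀ t ∈ U, z t = f t := by
  let G : Set (Q × EReal) := closure ((fun t => (t, f t)) '' U)
  have hG : IsClosed G := isClosed_closure
  have : CompactSpace G := isCompact_iff_compactSpace.1 hG.isCompact
  have hsurj : Function.Surjective fun p : G => p.1.1 := by
    have hcl : IsClosed (Prod.fst '' G) := (hG.isCompact.image continuous_fst).isClosed
    have hsub : U ⊆ Prod.fst '' G := fun t ht => ⟨(t, f t), subset_closure ⟨t, ht, rfl⟩, rfl⟩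
    intro t
    have ht : t ∈ Prod.fst '' G := closure_minimal hsub hcl (hd t)
    obtain ⟨p, hp, rfl⟩ := ht
    exact ⟨⟨p, hp⟩, rfl⟩
  obtain ⟨h, hc, hh⟩ := CompactT2.ExtremallyDisconnected.projective (A := Q)
    (f := id) continuous_id (continuous_fst.comp continuous_subtype_val) hsurj
  refine ⟨⟨fun t => (h t).1.2, continuous_snd.comp (continuous_subtype_val.comp hc)⟩, ?_⟩
  intro t ht
  by_contra hne
  have hfst : (h t).1.1 = t := congrFun hh t
  obtain ⟨V, W, hV, hW, hzV, hfW, hVW⟩ := t2_separation hne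
  have hN : IsOpen (U ∩ f ⁻¹' W) := hf.isOpen_inter_preimage hU hW
  have hmem : (h t).1 ∈ (U ∩ f ⁻¹' W) ×ˢ V := by
    refine ⟨?_, hzV⟩
    rw [hfst]
    exact ⟨ht, hfW⟩
  obtain ⟨p, ⟨hp1, hp2⟩, s, hs, rfl⟩ := mem_closure_iff.1 (h t).2 _ (hN.prod hV) hmem
  exact Set.disjoint_left.1 hVW hp2 hp1.2

/-- The filter generated by the dense open sets. -/
def denseOpen (Q : Type u) [TopologicalSpace Q] : Filter Q where
  sets := {s | ∃ U ⊆ s, IsOpen U ∧ Dense U}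
  univ_sets := ⟨univ, subset_univ _, isOpen_univ, dense_univ⟩
  sets_of_superset := fun ⟨U, hU, h⟩ hst => ⟨U, hU.trans hst, h⟩
  inter_sets := fun ⟨U, hU, hUo, hUd⟩ ⟨V, hV, hVo, hVd⟩ =>
    ⟨U ∩ V, inter_subset_inter hU hV, hUo.inter hVo, hUd.inter_of_isOpen_left hVd hUo⟩

end Extension

/-- `C_∞(Q)`: the continuous functions `Q → [-∞, +∞]` that take the values `±∞` only on a nowhere
dense set. -/
@[ext]
structure CInfty (Q : Type u) [TopologicalSpace Q] where
  /-- the underlying continuous function -/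
  toMap : C(Q, EReal)
  nowhereDense : IsNowhereDense {t | toMap t = ⊤ ∨ toMap t = ⊥}

namespace CInfty

section Basic

variable {Q : Type u} [TopologicalSpace Q]

instance : CoeFun (CInfty Q) fun _ => Q → EReal := ⟨fun x => x.toMap⟩

/-- The open dense set on which `x` is finite. -/
def finiteSet (x : CInfty Q) : Set Q := {t | x t ≠ ⊤ ∧ x t ≠ ⊥}

theorem isOpen_finiteSet (x : CInfty Q) : IsOpen x.finiteSet :=
  (isOpen_ne.preimage x.toMap.continuous).inter (isOpen_ne.preimage x.toMap.continuous)

theorem compl_finiteSet (x : CInfty Q) : x.finiteSetᶜ = {t | x t = ⊤ ∨ x t = ⊥} := by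
  ext t
  simp only [finiteSet, mem_compl_iff, mem_ofPred_eq]
  tauto

theorem dense_finiteSet (x : CInfty Q) : Dense x.finiteSet := by
  have h := x.nowhereDense
  rw [← compl_finiteSet, x.isOpen_finiteSet.isClosed_compl.isNowhereDense_iff,
    interior_eq_empty_iff_dense_compl, compl_compl] at h
  exact h

theorem coe_toReal {x : CInfty Q} {t : Q} (ht : t ∈ x.finiteSet) :
    (((x t).toReal : ℝ) : EReal) = x t := EReal.coe_toReal ht.1 ht.2

theorem eventually_finite (x : CInfty Q) : ∀ᶠ t in denseOpen Q, t ∈ x.finiteSet :=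
  ⟨x.finiteSet, Subset.rfl, x.isOpen_finiteSet, x.dense_finiteSet⟩

theorem continuousOn_toReal (x : CInfty Q) : ContinuousOn (fun t => (x t).toReal) x.finiteSet :=
  EReal.continuousOn_toReal.comp x.toMap.continuous.continuousOn fun t ht => by
    simp [ht.1, ht.2]

/-- Two elements of `C_∞(Q)` that agree on a dense open set are equal. -/
theorem eq_of_eventually {x y : CInfty Q}
    (h : ∀ᶠ t in denseOpen Q, (x t).toReal = (y t).toReal) : x = y := by
  obtain ⟨U, hU, -, hUd⟩ : {t | x t = y t} ∈ denseOpen Q := by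
    filter_upwards [h, x.eventually_finite, y.eventually_finite] with t h hx hy
    show x t = y t
    rw [← coe_toReal hx, ← coe_toReal hy, h]
  refine CInfty.ext (ContinuousMap.ext fun t => ?_)
  exact congrFun (Continuous.ext_on hUd x.toMap.continuous y.toMap.continuous hU) t

/-- A finite continuous function as an element of `C_∞(Q)`. -/
def ofReal (a : C(Q, ℝ)) : CInfty Q where
  toMap := ⟨fun t => (a t : EReal), continuous_coe_real_ereal.comp a.continuous⟩
  nowhereDense := by simp [IsNowhereDense]

@[simp] theorem ofReal_apply (a : C(Q, ℝ)) (t : Q) : ofReal a t = (a t : EReal) := rfl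

instance : Neg (CInfty Q) where
  neg x :=
    { toMap := ⟨fun t => -x t, continuous_neg.comp x.toMap.continuous⟩
      nowhereDense := by
        have h : {t | -x t = ⊤ ∨ -x t = ⊥} = {t | x t = ⊤ ∨ x t = ⊥} := by
          ext t
          simp only [mem_ofPred_eq, EReal.neg_eq_top_iff, EReal.neg_eq_bot_iff]
          tauto
        exact h ▸ x.nowhereDense }

theorem neg_apply (x : CInfty Q) (t : Q) : (-x) t = -x t := rfl

instance : Zero (CInfty Q) := ⟨ofReal 0⟩
instance : One (CInfty Q) := ⟨ofReal 1⟩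

theorem toReal_zero (t : Q) : ((0 : CInfty Q) t).toReal = 0 := EReal.toReal_coe 0

theorem toReal_one (t : Q) : ((1 : CInfty Q) t).toReal = 1 := EReal.toReal_coe 1

theorem toReal_ofReal (a : C(Q, ℝ)) (t : Q) : (ofReal a t).toReal = a t := EReal.toReal_coe _

theorem toReal_neg (x : CInfty Q) (t : Q) : ((-x) t).toReal = -(x t).toReal := by
  rw [neg_apply, EReal.toReal_neg_eq]

end Basic

variable {Q : Type u} [TopologicalSpace Q] [CompactSpace Q] [T2Space Q] [ExtremallyDisconnected Q]

theorem exists_map₂ (F : ℝ → ℝ → ℝ) (hF : Continuous fun p : ℝ × ℝ => F p.1 p.2)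
    (x y : CInfty Q) : ∃ z : CInfty Q, ∀ t ∈ x.finiteSet ∩ y.finiteSet,
      z t = (F (x t).toReal (y t).toReal : ℝ) := by
  have ho := x.isOpen_finiteSet.inter y.isOpen_finiteSet
  have hd := x.dense_finiteSet.inter_of_isOpen_left y.dense_finiteSet x.isOpen_finiteSet
  have hc : ContinuousOn (fun t => ((F (x t).toReal (y t).toReal : ℝ) : EReal))
      (x.finiteSet ∩ y.finiteSet) :=
    (continuous_coe_real_ereal.comp hF).comp_continuousOn
      ((x.continuousOn_toReal.mono inter_subset_left).prodMk
        (y.continuousOn_toReal.mono inter_subset_right))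
  obtain ⟨z, hz⟩ := exists_continuous_extension ho hd hc
  refine ⟨⟨z, ?_⟩, hz⟩
  refine IsNowhereDense.mono (t := {t | z t = ⊤ ∨ z t = ⊥})
    (s := (x.finiteSet ∩ y.finiteSet)ᶜ) ?_ ?_
  · intro t ht hmem
    rw [mem_ofPred_eq, hz t hmem] at ht
    exact ht.elim (EReal.coe_ne_top _) (EReal.coe_ne_bot _)
  · rw [ho.isClosed_compl.isNowhereDense_iff, interior_eq_empty_iff_dense_compl, compl_compl]
    exact hd

/-- The element of `C_∞(Q)` whose value is `F (x t) (y t)` at all points `t` where both `x` and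
`y` are finite; by density and continuity it is unique. -/
def map₂ (F : ℝ → ℝ → ℝ) (hF : Continuous fun p : ℝ × ℝ => F p.1 p.2) (x y : CInfty Q) :
    CInfty Q := (exists_map₂ F hF x y).choose

theorem map₂_apply (F : ℝ → ℝ → ℝ) (hF : Continuous fun p : ℝ × ℝ => F p.1 p.2)
    (x y : CInfty Q) {t : Q} (hx : t ∈ x.finiteSet) (hy : t ∈ y.finiteSet) :
    map₂ F hF x y t = (F (x t).toReal (y t).toReal : ℝ) :=
  (exists_map₂ F hF x y).choose_spec t ⟨hx, hy⟩

instance : Add (CInfty Q) := ⟨map₂ (fun a b => a + b) continuous_add⟩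
instance : Mul (CInfty Q) := ⟨map₂ (fun a b => a * b) continuous_mul⟩

theorem add_apply (x y : CInfty Q) {t : Q} (hx : t ∈ x.finiteSet) (hy : t ∈ y.finiteSet) :
    (x + y) t = (((x t).toReal + (y t).toReal : ℝ) : EReal) := map₂_apply _ _ x y hx hy

theorem mul_apply (x y : CInfty Q) {t : Q} (hx : t ∈ x.finiteSet) (hy : t ∈ y.finiteSet) :
    (x * y) t = (((x t).toReal * (y t).toReal : ℝ) : EReal) := map₂_apply _ _ x y hx hy

theorem toReal_add (x y : CInfty Q) :
    ∀ᶠ t in denseOpen Q, ((x + y) t).toReal = (x t).toReal + (y t).toReal := by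
  filter_upwards [x.eventually_finite, y.eventually_finite] with t hx hy
  rw [add_apply x y hx hy, EReal.toReal_coe]

theorem toReal_mul (x y : CInfty Q) :
    ∀ᶠ t in denseOpen Q, ((x * y) t).toReal = (x t).toReal * (y t).toReal := by
  filter_upwards [x.eventually_finite, y.eventually_finite] with t hx hy
  rw [mul_apply x y hx hy, EReal.toReal_coe]

instance : CommRing (CInfty Q) where
  add_assoc x y z := eq_of_eventually <| by
    filter_upwards [toReal_add (x + y) z, toReal_add x y, toReal_add x (y + z), toReal_add y z]
      with t h1 h2 h3 h4
    rw [h1, h2, h3, h4, add_assoc]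
  zero_add x := eq_of_eventually <| by
    filter_upwards [toReal_add 0 x] with t h
    rw [h, toReal_zero, zero_add]
  add_zero x := eq_of_eventually <| by
    filter_upwards [toReal_add x 0] with t h
    rw [h, toReal_zero, add_zero]
  add_comm x y := eq_of_eventually <| by
    filter_upwards [toReal_add x y, toReal_add y x] with t h1 h2
    rw [h1, h2, add_comm]
  neg_add_cancel x := eq_of_eventually <| by
    filter_upwards [toReal_add (-x) x] with t h
    rw [h, toReal_neg, toReal_zero, neg_add_cancel]
  mul_assoc x y z := eq_of_eventually <| by
    filter_upwards [toReal_mul (x * y) z, toReal_mul x y, toReal_mul x (y * z), toReal_mul y z]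
      with t h1 h2 h3 h4
    rw [h1, h2, h3, h4, mul_assoc]
  one_mul x := eq_of_eventually <| by
    filter_upwards [toReal_mul 1 x] with t h
    rw [h, toReal_one, one_mul]
  mul_one x := eq_of_eventually <| by
    filter_upwards [toReal_mul x 1] with t h
    rw [h, toReal_one, mul_one]
  mul_comm x y := eq_of_eventually <| by
    filter_upwards [toReal_mul x y, toReal_mul y x] with t h1 h2
    rw [h1, h2, mul_comm]
  zero_mul x := eq_of_eventually <| by
    filter_upwards [toReal_mul 0 x] with t h
    rw [h, toReal_zero, zero_mul]
  mul_zero x := eq_of_eventually <| by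
    filter_upwards [toReal_mul x 0] with t h
    rw [h, toReal_zero, mul_zero]
  left_distrib x y z := eq_of_eventually <| by
    filter_upwards [toReal_mul x (y + z), toReal_add y z, toReal_add (x * y) (x * z),
      toReal_mul x y, toReal_mul x z] with t h1 h2 h3 h4 h5
    rw [h1, h2, h3, h4, h5, mul_add]
  right_distrib x y z := eq_of_eventually <| by
    filter_upwards [toReal_mul (x + y) z, toReal_add x y, toReal_add (x * z) (y * z),
      toReal_mul x z, toReal_mul y z] with t h1 h2 h3 h4 h5
    rw [h1, h2, h3, h4, h5, add_mul]
  nsmul := nsmulRec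
  zsmul := zsmulRec

/-- The inclusion `C(Q) ⊂ C_∞(Q)` as a ring homomorphism. -/
def incl : C(Q, ℝ) →+* CInfty Q where
  toFun := ofReal
  map_one' := rfl
  map_zero' := rfl
  map_mul' a b := eq_of_eventually <| by
    filter_upwards [toReal_mul (ofReal a) (ofReal b)] with t h
    rw [h, toReal_ofReal, toReal_ofReal, toReal_ofReal, ContinuousMap.mul_apply]
  map_add' a b := eq_of_eventually <| by
    filter_upwards [toReal_add (ofReal a) (ofReal b)] with t h
    rw [h, toReal_ofReal, toReal_ofReal, toReal_ofReal, ContinuousMap.add_apply]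

@[simp] theorem incl_apply (a : C(Q, ℝ)) (t : Q) : incl a t = (a t : EReal) := rfl

/-- `C_∞(Q)` as an algebra over `ℝ`: a real number acts as the constant function. -/
instance : Algebra ℝ (CInfty Q) := (incl.comp (algebraMap ℝ C(Q, ℝ))).toAlgebra

end CInfty

/-! ### The algebra `L⁰(B)`, supports and derivations -/

section LZero

variable {B : Type u} [CompleteBooleanAlgebra B]

/-- `L⁰(B) = C_∞(Q)` for the Stone space `Q` of the complete Boolean algebra `B`. -/
abbrev LZero (B : Type u) [CompleteBooleanAlgebra B] : Type u := CInfty (StoneSpace B)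

/-- The indicator function of the clopen set `Q(e)`. -/
def idemFun (e : B) : C(StoneSpace B, ℝ) where
  toFun := (StoneSpace.clopen e).indicator 1
  continuous_toFun := (StoneSpace.isClopen_clopen e).continuous_indicator continuous_const

/-- The element `e` of `B` as an idempotent of `L⁰(B)`. -/
def idem (e : B) : LZero B := CInfty.incl (idemFun e)

/-- The support `s(x) = 1 - sup {e ∈ B : e x = 0}` of `x ∈ L⁰(B)`. -/
def supp (x : LZero B) : B := (sSup {e : B | idem e * x = 0})ᶜ

/-- The support `s(X) = sup {s(x) : x ∈ X}` of an ideal `X` of `C(Q)`. -/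
def idealSupp (X : Ideal C(StoneSpace B, ℝ)) : B := ⨆ x : X, supp (CInfty.incl x.1)

/-- A linear map `δ : X → L⁰(B)` on an ideal `X` of `C(Q)` is a derivation if
`δ(xy) = δ(x)y + xδ(y)` for all `x, y ∈ X`. -/
def IsIdealDerivation (X : Ideal C(StoneSpace B, ℝ)) (δ : X →ₗ[ℝ] LZero B) : Prop :=
  ∀ x y : X, δ ⟨x.1 * y.1, X.mul_mem_left x.1 y.2⟩ =
    δ x * CInfty.incl y.1 + CInfty.incl x.1 * δ y

/-- `δ` is band preserving if `s(δ(x)) ≤ s(x)` for all `x ∈ X`. -/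
def IsBandPreserving (X : Ideal C(StoneSpace B, ℝ)) (δ : X →ₗ[ℝ] LZero B) : Prop :=
  ∀ x : X, supp (δ x) ≤ supp (CInfty.incl x.1)

end LZero

end

universe u

/-! Every `z` in `C_∞(Q)` is a fraction `a / b` with `a`, `b` in `C(Q)` and `b` regular
(`exists_fraction`). For `x` in `X`, applying an extending derivation `D` to `(b x) z = a x` forces
`x b · D z = δ(a x) - δ(b x) z`. When `s(X) = 1` only zero annihilates `X`, so this gives
uniqueness. For existence the same formula defines `D z` as the common quotient `q / p` over all
`x`, `a`, `b` with `b z = a`. Expanding `δ((a x)(b' y)) = δ((b x)(a' y))` by Leibniz shows that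
these quotients agree on overlaps, and band preservation shows that `q` vanishes where `p` does.
Extremal disconnectedness of `Q` glues them into one element (`exists_common_quotient`), set to zero
off the support of `X`. That normalization makes the value unique (`IsExtensionValue.eq`), so
additivity, homogeneity and the Leibniz rule follow by checking the defining equations on one
fraction. -/

namespace CInfty

/-! ### Generic values and the nonvanishing locus -/

section Germs

variable {Q : Type u} [TopologicalSpace Q]

theorem eventually_of_isOpen_of_dense {U : Set Q} (hU : IsOpen U) (hd : Dense U) {P : Q → Prop}
    (h : ∀ t ∈ U, P t) : ∀ᶠ t in denseOpen Q, P t :=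
  ⟨U, h, hU, hd⟩

theorem exists_mem_of_eventually {P : Q → Prop} (h : ∀ᶠ t in denseOpen Q, P t) {V : Set Q}
    (hV : IsOpen V) (hne : V.Nonempty) : ∃ t ∈ V, P t := by
  obtain ⟨U, hU, -, hd⟩ := h
  obtain ⟨t, htV, htU⟩ := hd.inter_open_nonempty V hV hne
  exact ⟨t, htV, hU htU⟩

theorem eq_zero_of_eventually {x : CInfty Q} (h : ∀ᶠ t in denseOpen Q, (x t).toReal = 0) :
    x = 0 :=
  eq_of_eventually (h.mono fun t ht => by rw [ht, toReal_zero])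

/-- The open set on which `x` is finite and nonzero. -/
def unitSet (x : CInfty Q) : Set Q := {t | t ∈ x.finiteSet ∧ x t ≠ 0}

theorem isOpen_unitSet (x : CInfty Q) : IsOpen x.unitSet :=
  x.isOpen_finiteSet.inter (isOpen_ne.preimage x.toMap.continuous)

theorem toReal_ne_zero {x : CInfty Q} {t : Q} (ht : t ∈ x.unitSet) : (x t).toReal ≠ 0 := by
  intro h
  apply ht.2
  rw [← coe_toReal ht.1, h, EReal.coe_zero]

theorem mem_unitSet {x : CInfty Q} {t : Q} (ht : t ∈ x.finiteSet) (h : (x t).toReal ≠ 0) :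
    t ∈ x.unitSet :=
  ⟨ht, fun h0 => h (by rw [h0, EReal.toReal_zero])⟩

theorem nonempty_unitSet {x : CInfty Q} (hx : x ≠ 0) : x.unitSet.Nonempty := by
  by_contra hne
  refine hx (eq_zero_of_eventually ?_)
  filter_upwards [x.eventually_finite] with t ht
  by_contra h
  exact hne ⟨t, mem_unitSet ht h⟩

end Germs

/-! ### Reducedness, fractions and gluing in `C_∞(Q)` -/

variable {Q : Type u} [TopologicalSpace Q] [CompactSpace Q] [T2Space Q] [ExtremallyDisconnected Q]

theorem toReal_mul_eq_zero {x y : CInfty Q} (h : x * y = 0) :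
    ∀ᶠ t in denseOpen Q, (x t).toReal * (y t).toReal = 0 := by
  filter_upwards [toReal_mul x y] with t ht
  rw [← ht, h, toReal_zero]

theorem toReal_mul_eq_zero_of_finite {x y : CInfty Q} (h : x * y = 0) {t : Q}
    (hx : t ∈ x.finiteSet) (hy : t ∈ y.finiteSet) : (x t).toReal * (y t).toReal = 0 := by
  have := mul_apply x y hx hy
  rw [h] at this
  exact EReal.coe_eq_zero.1 this.symm

/-- Values are generically real, so the ring is reduced. Below, differences are shown to vanish by
killing their squares. -/
theorem eq_zero_of_mul_self {x : CInfty Q} (h : x * x = 0) : x = 0 := by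
  refine eq_zero_of_eventually ?_
  filter_upwards [toReal_mul_eq_zero h] with t ht
  exact mul_self_eq_zero.1 ht

/-- A bounded continuous function on a dense open set extends to the whole space. -/
theorem exists_bounded_extension {U : Set Q} (hU : IsOpen U) (hd : Dense U) {f : Q → ℝ}
    (hf : ContinuousOn f U) (hb : ∀ t ∈ U, |f t| ≤ 1) : ∃ b : C(Q, ℝ), ∀ t ∈ U, b t = f t := by
  obtain ⟨z, hz⟩ := exists_continuous_extension hU hd
    (f := fun t => (f t : EReal)) (continuous_coe_real_ereal.comp_continuousOn hf)
  have hmem : ∀ t, z t ∈ Icc ((-1 : ℝ) : EReal) ((1 : ℝ) : EReal) := by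
    have hcl : IsClosed (z ⁻¹' Icc ((-1 : ℝ) : EReal) ((1 : ℝ) : EReal)) :=
      isClosed_Icc.preimage z.continuous
    intro t
    refine closure_minimal (fun s hs => ?_) hcl (hd t)
    rw [mem_preimage, hz s hs]
    exact ⟨EReal.coe_le_coe_iff.2 (abs_le.1 (hb s hs)).1,
      EReal.coe_le_coe_iff.2 (abs_le.1 (hb s hs)).2⟩
  refine ⟨⟨fun t => (z t).toReal, EReal.continuousOn_toReal.comp_continuous z.continuous
    fun t => ?_⟩, fun t ht => ?_⟩
  · have h1 : z t ≠ ⊥ := ((EReal.bot_lt_coe _).trans_le (hmem t).1).ne'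
    have h2 : z t ≠ ⊤ := ((hmem t).2.trans_lt (EReal.coe_lt_top _)).ne
    simp [h1, h2]
  · show (z t).toReal = f t
    rw [hz t ht, EReal.toReal_coe]

/-- Every element of `C_∞(Q)` is a fraction of elements of `C(Q)` with a regular denominator. -/
theorem exists_fraction (z : CInfty Q) : ∃ a b : C(Q, ℝ), incl b * z = incl a ∧
    ∀ d : CInfty Q, incl b * d = 0 → d = 0 := by
  have hpos : ∀ r : ℝ, 0 < 1 + r ^ 2 := fun r => by positivity
  have hc := z.continuousOn_toReal
  have hden : ContinuousOn (fun t => 1 + (z t).toReal ^ 2) z.finiteSet :=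
    continuousOn_const.add (hc.pow 2)
  -- The fraction is `z = (z / (1 + z²)) / (1 / (1 + z²))`: both parts are bounded by 1, and the
  -- denominator has no zero on the dense set where `z` is finite.
  obtain ⟨b, hb⟩ := exists_bounded_extension z.isOpen_finiteSet z.dense_finiteSet
    (f := fun t => 1 / (1 + (z t).toReal ^ 2))
    (continuousOn_const.div hden fun t _ => (hpos _).ne') (fun t _ => by
      rw [abs_of_pos (one_div_pos.2 (hpos _)), div_le_one (hpos _)]
      nlinarith [sq_nonneg (z t).toReal])
  obtain ⟨a, ha⟩ := exists_bounded_extension z.isOpen_finiteSet z.dense_finiteSet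
    (f := fun t => (z t).toReal / (1 + (z t).toReal ^ 2))
    (hc.div hden fun t _ => (hpos _).ne') (fun t _ => by
      rw [abs_div, abs_of_pos (hpos _), div_le_one (hpos _), abs_le]
      constructor <;> nlinarith [sq_nonneg ((z t).toReal - 1), sq_nonneg ((z t).toReal + 1)])
  refine ⟨a, b, eq_of_eventually ?_, fun d hd => eq_zero_of_eventually ?_⟩
  · filter_upwards [toReal_mul (incl b) z, z.eventually_finite] with t h ht
    rw [h]
    show (ofReal b t).toReal * _ = (ofReal a t).toReal
    rw [toReal_ofReal, toReal_ofReal, ha t ht, hb t ht]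
    ring
  · filter_upwards [toReal_mul_eq_zero hd, z.eventually_finite] with t h ht
    refine (mul_eq_zero.1 h).resolve_left ?_
    show (ofReal b t).toReal ≠ 0
    rw [toReal_ofReal, hb t ht]
    exact (one_div_pos.2 (hpos _)).ne'

/-- A compatible family of fractions `q i / p i` is represented by one element of `C_∞(Q)`. -/
theorem exists_common_quotient {ι : Type*} (p q : ι → CInfty Q)
    (hpq : ∀ i j, p i * q j = p j * q i) (hann : ∀ i v, v * p i = 0 → v * q i = 0) :
    ∃ w : CInfty Q, (∀ i, p i * w = q i) ∧ ∀ v, (∀ i, v * p i = 0) → v * w = 0 := by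
  classical
  let W : ι → Set Q := fun i => (p i).unitSet ∩ (q i).finiteSet
  have hW : ∀ i, IsOpen (W i) := fun i => (p i).isOpen_unitSet.inter (q i).isOpen_finiteSet
  let G : Set Q := ⋃ i, W i
  have hG : IsOpen G := isOpen_iUnion hW
  let f : Q → ℝ := fun t => if h : ∃ i, t ∈ W i then
    (q h.choose t).toReal / (p h.choose t).toReal else 0
  have hfW : ∀ i, ∀ t ∈ W i, f t = (q i t).toReal / (p i t).toReal := by
    intro i t ht
    have h : ∃ i, t ∈ W i := ⟨i, ht⟩
    have hj := h.choose_spec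
    simp only [f, dif_pos h]
    generalize h.choose = j at hj
    -- The quotient does not depend on the chosen index, by the cross-multiplied identity `hpq`.
    rw [div_eq_div_iff (toReal_ne_zero hj.1) (toReal_ne_zero ht.1)]
    have h1 := mul_apply (p i) (q j) ht.1.1 hj.2
    rw [hpq i j, mul_apply (p j) (q i) hj.1.1 ht.2, EReal.coe_eq_coe_iff] at h1
    linarith
  have hfG : ∀ t, t ∉ G → f t = 0 := by
    intro t ht
    have h : ¬ ∃ i, t ∈ W i := fun ⟨i, hi⟩ => ht (mem_iUnion.2 ⟨i, hi⟩)
    simp only [f, dif_neg h]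
  -- Continuity of `f` can fail only on the boundary of `G`, which is nowhere dense; outside
  -- `closure G` it is locally zero.
  let U : Set Q := G ∪ (closure G)ᶜ
  have hU : IsOpen U := hG.union isClosed_closure.isOpen_compl
  have hd : Dense U := by
    intro t
    by_cases h : t ∈ closure G
    · exact closure_mono subset_union_left h
    · exact subset_closure (Or.inr h)
  have hc : ContinuousOn (fun t => (f t : EReal)) U := by
    refine continuous_coe_real_ereal.comp_continuousOn fun t ht => ContinuousAt.continuousWithinAt ?_
    rcases ht with ht | ht
    · obtain ⟨i, hi⟩ := mem_iUnion.1 ht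
      have h1 : ContinuousOn (fun t => (q i t).toReal / (p i t).toReal) (W i) :=
        ((q i).continuousOn_toReal.mono fun s hs => hs.2).div
          ((p i).continuousOn_toReal.mono fun s hs => hs.1.1) fun s hs => toReal_ne_zero hs.1
      refine (h1.continuousAt ((hW i).mem_nhds hi)).congr ?_
      filter_upwards [(hW i).mem_nhds hi] with s hs using (hfW i s hs).symm
    · refine (continuousAt_const (y := (0 : ℝ))).congr ?_
      filter_upwards [isClosed_closure.isOpen_compl.mem_nhds ht] with s hs
      exact (hfG s fun h => hs (subset_closure h)).symm
  obtain ⟨z, hz⟩ := exists_continuous_extension hU hd hc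
  have hnd : IsNowhereDense {t | z t = ⊤ ∨ z t = ⊥} := by
    refine IsNowhereDense.mono (s := Uᶜ) ?_ ?_
    · intro t ht hmem
      rw [mem_ofPred_eq, hz t hmem] at ht
      exact ht.elim (EReal.coe_ne_top _) (EReal.coe_ne_bot _)
    · rw [hU.isClosed_compl.isNowhereDense_iff, interior_eq_empty_iff_dense_compl, compl_compl]
      exact hd
  let w : CInfty Q := ⟨z, hnd⟩
  have hw : ∀ᶠ t in denseOpen Q, (w t).toReal = f t :=
    eventually_of_isOpen_of_dense hU hd fun t ht => by
      show (z t).toReal = f t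
      rw [hz t ht, EReal.toReal_coe]
  -- The extra factor `p i` absorbs the points where `p i` vanishes, at which `f` says nothing about
  -- `q i`.
  have hpw : ∀ i, p i * (p i * w) = p i * q i := by
    refine fun i => eq_of_eventually ?_
    filter_upwards [toReal_mul (p i) (p i * w), toReal_mul (p i) w, toReal_mul (p i) (q i), hw,
      (p i).eventually_finite, (q i).eventually_finite] with t h1 h2 h3 h4 h5 h6
    rw [h1, h2, h3, h4]
    by_cases h : (p i t).toReal = 0
    · simp [h]
    · rw [hfW i t ⟨mem_unitSet h5 h, h6⟩, mul_div_cancel₀ _ h]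
  refine ⟨w, fun i => ?_, fun v hv => eq_zero_of_eventually ?_⟩
  · have h1 : (p i * w - q i) * p i = 0 := by linear_combination hpw i
    -- The factor is cancelled: `d = p i * w - q i` kills `p i`, hence `q i`, hence itself.
    have h2 := hann i _ h1
    exact sub_eq_zero.1 (eq_zero_of_mul_self (by linear_combination w * h1 - h2))
  · filter_upwards [toReal_mul v w, hw, v.eventually_finite] with t h1 h2 h3
    rw [h1, h2]
    by_cases ht : t ∈ G
    · obtain ⟨i, hi⟩ := mem_iUnion.1 ht
      rw [(mul_eq_zero.1 (toReal_mul_eq_zero_of_finite (hv i) h3 hi.1.1)).resolve_right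
        (toReal_ne_zero hi.1), zero_mul]
    · rw [hfG t ht, mul_zero]

theorem incl_smul (r : ℝ) (a : C(Q, ℝ)) : incl (r • a) = r • incl a := by
  rw [Algebra.smul_def, Algebra.smul_def, map_mul]
  rfl

end CInfty

/-! ### Supports and annihilators -/

section Support

open CInfty StoneSpace

variable {B : Type u} [CompleteBooleanAlgebra B]

theorem exists_clopen_subset_unitSet {x : LZero B} (hx : x ≠ 0) :
    ∃ e : B, e ≠ ⊥ ∧ clopen e ⊆ x.unitSet := by
  obtain ⟨t, ht⟩ := nonempty_unitSet hx
  obtain ⟨e, hte, he⟩ := exists_clopen_subset x.isOpen_unitSet ht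
  refine ⟨e, ?_, he⟩
  rintro rfl
  exact Bool.false_ne_true (t.val_bot.symm.trans hte)

theorem idem_mul_eq_zero_iff (e : B) (x : LZero B) :
    idem e * x = 0 ↔ ∀ᶠ t in denseOpen (StoneSpace B), t ∈ clopen e → (x t).toReal = 0 := by
  have hval : ∀ t, (idem e t).toReal = (clopen e).indicator 1 t := fun t => toReal_ofReal _ t
  constructor
  · intro h
    filter_upwards [toReal_mul_eq_zero h] with t ht hte
    rw [hval, indicator_of_mem hte] at ht
    simpa using ht
  · intro h
    refine eq_zero_of_eventually ?_
    filter_upwards [h, toReal_mul (idem e) x] with t ht h2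
    rw [h2, hval]
    by_cases hte : t ∈ clopen e
    · rw [ht hte, mul_zero]
    · rw [indicator_of_notMem hte, zero_mul]

/-- If `v` does not vanish on `Q(e)` and `v x = 0`, then `e` is disjoint from the support of
`x`. -/
theorem le_compl_supp {e : B} {v x : LZero B} (he : clopen e ⊆ v.unitSet) (h : v * x = 0) :
    e ≤ (supp x)ᶜ := by
  rw [supp, compl_compl]
  refine le_sSup ((idem_mul_eq_zero_iff e x).2 ?_)
  filter_upwards [toReal_mul_eq_zero h] with t ht hte
  exact (mul_eq_zero.1 ht).resolve_left (toReal_ne_zero (he hte))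

/-- This turns band preservation into algebra: whatever annihilates `x` annihilates `δ x`. If `v y`
were nonzero on some `Q(e)`, then `e` would be disjoint from the support of `x`, hence from that of
`y`. -/
theorem mul_eq_zero_of_supp_le {x y v : LZero B} (h : supp y ≤ supp x) (hv : v * x = 0) :
    v * y = 0 := by
  by_contra hne
  obtain ⟨e, he0, he⟩ := exists_clopen_subset_unitSet hne
  have hex : e ≤ (supp x)ᶜ := le_compl_supp he (by linear_combination y * hv)
  have hey : e ≤ sSup {f : B | idem f * y = 0} := by
    have := hex.trans (compl_le_compl h)
    rwa [supp, compl_compl] at this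
  refine he0 (le_bot_iff.1 ?_)
  -- By infinite distributivity it suffices that `e` meets no single `f` with `f y = 0`.
  rw [← inf_eq_left.2 hey, inf_sSup_eq]
  refine iSup₂_le fun f hf => ?_
  by_contra hef
  obtain ⟨t, hte, ht, hmul⟩ := exists_mem_of_eventually
    (((idem_mul_eq_zero_iff f y).1 hf).and (toReal_mul v y)) (isClopen_clopen (e ⊓ f)).isOpen
    (nonempty_clopen fun h0 => hef h0.le)
  have hboth : t.val e = true ∧ t.val f = true := by
    have h1 : t.val (e ⊓ f) = true := hte
    simpa using h1
  exact toReal_ne_zero (he hboth.1) (by rw [hmul, ht hboth.2, mul_zero])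

theorem eq_zero_of_idealSupp_eq_top {X : Ideal C(StoneSpace B, ℝ)} (hX : idealSupp X = ⊤)
    {v : LZero B} (hv : ∀ x : X, v * incl x.1 = 0) : v = 0 := by
  by_contra hne
  obtain ⟨e, he0, he⟩ := exists_clopen_subset_unitSet hne
  have h : idealSupp X ≤ eᶜ := iSup_le fun x => le_compl_comm.1 (le_compl_supp he (hv x))
  rw [hX, top_le_iff, compl_eq_top] at h
  exact he0 h

end Support

/-! ### Construction and uniqueness of the extension -/

section Extension

open CInfty

variable {B : Type u} [CompleteBooleanAlgebra B] {X : Ideal C(StoneSpace B, ℝ)}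
  {δ : X →ₗ[ℝ] LZero B}

theorem IsIdealDerivation.map_smul (hder : IsIdealDerivation X δ) (x y : X) :
    δ (x.1 • y) = δ x * incl y.1 + incl x.1 * δ y :=
  hder x y

/-- `w` is a possible value at `z` of a derivation that extends `δ` and vanishes where all
elements of `X` vanish. -/
structure IsExtensionValue (δ : X →ₗ[ℝ] LZero B) (z w : LZero B) : Prop where
  mul_eq : ∀ (x : X) (a b : C(StoneSpace B, ℝ)), incl b * z = incl a →
    incl x.1 * incl b * w = δ (a • x) - δ (b • x) * z
  mul_eq_zero : ∀ v, (∀ x : X, v * incl x.1 = 0) → v * w = 0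

theorem exists_isExtensionValue (hder : IsIdealDerivation X δ) (hband : IsBandPreserving X δ)
    (z : LZero B) : ∃ w, IsExtensionValue δ z w := by
  let ι := {i : X × C(StoneSpace B, ℝ) × C(StoneSpace B, ℝ) // incl i.2.2 * z = incl i.2.1}
  let p : ι → LZero B := fun i => incl (i.1.2.2 • i.1.1).1
  let q : ι → LZero B := fun i => δ (i.1.2.1 • i.1.1) - δ (i.1.2.2 • i.1.1) * z
  have hpq : ∀ i j, p i * q j = p j * q i := by
    rintro ⟨⟨x, a, b⟩, h : incl b * z = incl a⟩ ⟨⟨y, a', b'⟩, h' : incl b' * z = incl a'⟩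
    show incl (b • x).1 * (δ (a' • y) - δ (b' • y) * z) =
      incl (b' • y).1 * (δ (a • x) - δ (b • x) * z)
    have h1 := hder.map_smul (a • x) (b' • y)
    have h2 := hder.map_smul (b • x) (a' • y)
    have hab : a * b' = b * a' := by
      have hinj : Function.Injective (incl : C(StoneSpace B, ℝ) →+* LZero B) := by
        intro f g hfg
        ext t
        have := congrArg (fun u : LZero B => u t) hfg
        exact EReal.coe_eq_coe_iff.1 this
      apply hinj
      rw [map_mul, map_mul, ← h, ← h']
      ring
    -- Two factorizations of one element of `X`; equating their Leibniz expansions is the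
    -- compatibility of the quotients.
    have h3 : (a • x).1 • (b' • y) = (b • x).1 • (a' • y) := by
      ext1
      simp only [Submodule.coe_smul, smul_eq_mul]
      linear_combination (x.1 * y.1) * hab
    rw [h3, h2] at h1
    simp only [Submodule.coe_smul, smul_eq_mul, map_mul, ← h, ← h'] at h1 ⊢
    linear_combination h1
  have hann : ∀ i v, v * p i = 0 → v * q i = 0 := by
    rintro ⟨⟨x, a, b⟩, h : incl b * z = incl a⟩ v (hv : v * incl (b * x.1) = 0)
    have hb : v * δ (b • x) = 0 := mul_eq_zero_of_supp_le (hband _) hv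
    have ha : v * δ (a • x) = 0 := by
      refine mul_eq_zero_of_supp_le (hband _) ?_
      rw [map_mul] at hv
      rw [Submodule.coe_smul, smul_eq_mul, map_mul, ← h]
      linear_combination z * hv
    show v * (δ (a • x) - δ (b • x) * z) = 0
    linear_combination ha - z * hb
  obtain ⟨w, hw, hw'⟩ := exists_common_quotient p q hpq hann
  refine ⟨w, fun x a b hab => ?_, fun v hv => hw' v fun i => hv _⟩
  rw [← show p ⟨(x, a, b), hab⟩ * w = δ (a • x) - δ (b • x) * z from hw ⟨(x, a, b), hab⟩]
  simp only [p, Submodule.coe_smul, smul_eq_mul, map_mul]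
  ring

/-- One fraction with regular denominator suffices: `d = w - w'` annihilates `X`, so both
normalizations give `d w = d w' = 0`, and `d² = 0`. -/
theorem IsExtensionValue.eq {z w w' : LZero B} (hw : IsExtensionValue δ z w)
    (hw' : ∀ v, (∀ x : X, v * incl x.1 = 0) → v * w' = 0) {a b : C(StoneSpace B, ℝ)}
    (hab : incl b * z = incl a) (hb : ∀ d : LZero B, incl b * d = 0 → d = 0)
    (h : ∀ x : X, incl x.1 * incl b * w' = δ (a • x) - δ (b • x) * z) : w = w' := by
  have hd : ∀ x : X, (w - w') * incl x.1 = 0 := fun x =>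
    hb _ (by linear_combination hw.mul_eq x a b hab - h x)
  refine sub_eq_zero.1 (eq_zero_of_mul_self ?_)
  linear_combination hw.mul_eq_zero _ hd - hw' _ hd

theorem eq_zero_of_incl_mul {b b' : C(StoneSpace B, ℝ)}
    (hb : ∀ d : LZero B, incl b * d = 0 → d = 0) (hb' : ∀ d : LZero B, incl b' * d = 0 → d = 0)
    (d : LZero B) (h : incl (b * b') * d = 0) : d = 0 :=
  hb' _ (hb _ (by rw [← h, map_mul, mul_assoc]))

theorem exists_derivation (hder : IsIdealDerivation X δ) (hband : IsBandPreserving X δ) :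
    ∃ D : Derivation ℝ (LZero B) (LZero B), ∀ x : X, D (incl x.1) = δ x := by
  choose D hD using exists_isExtensionValue hder hband
  have hadd : ∀ z z', D (z + z') = D z + D z' := by
    intro z z'
    obtain ⟨a, b, hab, hb⟩ := exists_fraction z
    obtain ⟨a', b', hab', hb'⟩ := exists_fraction z'
    refine (hD _).eq (a := a * b' + a' * b) (b := b * b') ?_ ?_ (eq_zero_of_incl_mul hb hb') ?_
    · intro v hv
      linear_combination (hD z).mul_eq_zero v hv + (hD z').mul_eq_zero v hv
    · simp only [map_mul, map_add, ← hab, ← hab']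
      ring
    · intro x
      -- Scaling `x` by the other denominator brings both equations to the denominator `b b'`.
      have h1 := (hD z).mul_eq (b' • x) a b hab
      have h2 := (hD z').mul_eq (b • x) a' b' hab'
      rw [smul_smul] at h1 h2
      rw [smul_smul] at h1 h2
      rw [mul_comm b b'] at h1 ⊢
      rw [add_smul, map_add]
      simp only [Submodule.coe_smul, smul_eq_mul, map_mul] at h1 h2 ⊢
      linear_combination h1 + h2
  have hsmul : ∀ (r : ℝ) z, D (r • z) = r • D z := by
    intro r z
    obtain ⟨a, b, hab, hb⟩ := exists_fraction z
    refine (hD _).eq (a := r • a) (b := b) ?_ ?_ hb ?_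
    · intro v hv
      rw [mul_smul_comm, (hD z).mul_eq_zero v hv, smul_zero]
    · rw [incl_smul, ← hab, mul_smul_comm]
    · intro x
      have h1 : (r • a) • x = r • (a • x) := smul_assoc r a x
      rw [h1, LinearMap.map_smul, mul_smul_comm, mul_smul_comm, (hD z).mul_eq x a b hab, smul_sub]
  have hmul : ∀ z z', D (z * z') = z * D z' + z' * D z := by
    intro z z'
    obtain ⟨a, b, hab, hb⟩ := exists_fraction z
    obtain ⟨a', b', hab', hb'⟩ := exists_fraction z'
    refine (hD _).eq (a := a * a') (b := b * b') ?_ ?_ (eq_zero_of_incl_mul hb hb') ?_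
    · intro v hv
      linear_combination z' * (hD z).mul_eq_zero v hv + z * (hD z').mul_eq_zero v hv
    · simp only [map_mul, ← hab, ← hab']
      ring
    · intro x
      -- With `x` scaled by `b'` for `z` and by `a` for `z'`, the term `δ(a b' x) z'` cancels in `z'
      -- * h1 + h2`.
      have h1 := (hD z).mul_eq (b' • x) a b hab
      have h2 := (hD z').mul_eq (a • x) a' b' hab'
      simp only [smul_smul, Submodule.coe_smul, smul_eq_mul, map_mul] at h1 h2 ⊢
      rw [mul_comm b b', mul_comm a a']
      rw [mul_comm b b', mul_comm a b'] at h1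
      rw [← hab] at h2
      linear_combination z' * h1 + h2
  refine ⟨Derivation.mk' ⟨⟨D, hadd⟩, hsmul⟩ hmul, fun y => ?_⟩
  -- With the fraction `y / 1`, the defining equation for `δ y` is the Leibniz rule for `x y`, and
  -- the normalization is band preservation.
  refine (hD _).eq (a := y.1) (b := 1) (fun v hv => mul_eq_zero_of_supp_le (hband y) (hv y))
    (by rw [map_one, one_mul]) (fun d hd => by rwa [map_one, one_mul] at hd) fun x => ?_
  rw [hder.map_smul y x, one_smul, map_one]
  ring

theorem derivation_eq_of_idealSupp_eq_top (hX : idealSupp X = ⊤)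
    {D D' : Derivation ℝ (LZero B) (LZero B)} (h : ∀ x : X, D (incl x.1) = D' (incl x.1)) :
    D = D' := by
  ext1 z
  obtain ⟨a, b, hab, hb⟩ := exists_fraction z
  refine sub_eq_zero.1 (eq_zero_of_idealSupp_eq_top hX fun x => hb _ ?_)
  have h1 := h (a • x)
  have h2 := h (b • x)
  have h3 : incl (a • x).1 = incl (b • x).1 * z := by
    simp only [Submodule.coe_smul, smul_eq_mul, map_mul, ← hab]
    ring
  -- Both derivations agree on `b x` and on `(b x) z = a x`, so Leibniz leaves `b x (D z - D' z) =
  -- 0`.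
  rw [h3, Derivation.leibniz, Derivation.leibniz, h2] at h1
  simp only [Submodule.coe_smul, smul_eq_mul, map_mul] at h1
  linear_combination h1

end Extension

theorem mainTheorem5 {B : Type*} [CompleteBooleanAlgebra B]
    (X : Ideal C(StoneSpace B, ℝ)) (δ : X →ₗ[ℝ] LZero B)
    (hder : IsIdealDerivation X δ) (hband : IsBandPreserving X δ) :
    (∃ D : Derivation ℝ (LZero B) (LZero B), ∀ x : X, D (CInfty.incl x.1) = δ x) ∧
      (idealSupp X = ⊤ →
        ∃! D : Derivation ℝ (LZero B) (LZero B), ∀ x : X, D (CInfty.incl x.1) = δ x) := by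
  obtain ⟨D, hD⟩ := exists_derivation hder hband
  exact ⟨⟨D, hD⟩, fun hX => ⟨D, hD, fun D' hD' =>
    derivation_eq_of_idealSupp_eq_top hX fun x => (hD' x).trans (hD x).symm⟩⟩
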